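/- Consider forecasting over a known horizon $n$: in round $t=1,\dots,n$ the player predicts $x_t\in\mathbb R$ from the past observations $y_1,\dots,y_{t-1}$ and then observes $y_t=\theta_t+Z_t$, where $\theta_{1:n}\in\mathbb R^n$ is a fixed unknown sequence and $Z_1,\dots,Z_n$ are independent zero-mean subgaussian random variables with $\mathrm{Var}(Z_t)\ge\sigma^2$. With $\ell_t(x)=(x-\theta_t)^2$, the dynamic regret is $\mathbb E\big[\sum_{t=1}^n \ell_t(x_t)\big]-\sum_{t=1}^n\inf_x\ell_t(x)=\mathbb E\big[\sum_{t=1}^n (x_t-\theta_t)^2\big]$. Let $\mathrm{TV}(C,U)$ be the set of $\theta_{1:n}\in\mathbb R^n$ with $\sum_{t=2}^n|\theta_t-\theta_{t-1}|\le C$ and $|\theta_1|\le U$. A forecaster is called linear if $x_{1:n}=A\,y_{1:n}$ for a fixed matrix $A\in\mathbb R^{n\times n}$ with $A_{ts}=0$ for $s\ge t$. Online gradient descent with a fixed restart schedule is given by a starting point $x_1$, step sizes $\eta_t\in\mathbb R$ and a set of restart times, all fixed in advance: $x_{t+1}=x_1$ if $t+1$ is a restart time, and $x_{t+1}=x_t-\eta_t\cdot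 2(x_t-y_t)$ otherwise. (i) Online gradient descent with a fixed restart schedule and starting point $0$ is a linear forecaster; with an arbitrary starting point $x_1$ its predictions are $A\,y_{1:n}+b$ with $A$ as above and a fixed vector $b$. (ii) There is a universal constant $c>0$ such that for all $n\ge 2$, $C>0$, $U\ge 0$, all $\sigma$ with $0<\sigma\le C\sqrt n$, and all such noise, every linear forecaster, and every online gradient descent with a fixed restart schedule (with any starting point, step sizes and restart times, which may depend on $n,C,U,\sigma$), has dynamic regret at least $c\,\sigma\,C\sqrt n$ for some $\theta_{1:n}\in\mathrm{TV}(C,U)$. In particular, for fixed $C,\sigma>0$ the worst-case dynamic regret over the class is $\tilde\Omega(\sqrt n)$ (indeed $\Omega(\sqrt n)$). -/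

import Mathlib

open MeasureTheory ProbabilityTheory

noncomputable section

/-- A forecasting strategy over the horizon `n` (rounds are numbered `0, …, n - 1`): in round `t`
it maps the `t` observations made so far to a prediction. -/
abbrev Forecaster (n : ℕ) : Type := (t : Fin n) → (Fin (t : ℕ) → ℝ) → ℝ

/-- The vector of predictions when the observations are `y`. -/
def predictions {n : ℕ} (F : Forecaster n) (y : Fin n → ℝ) : Fin n → ℝ :=
  fun t => F t (fun s => y (Fin.castLE t.isLt.le s))

/-- The predictions are a fixed linear transformation of the observations, and the prediction of
each round is a linear combination of the strictly earlier observations. -/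
def IsLinearForecaster {n : ℕ} (F : Forecaster n) : Prop :=
  ∃ A : Matrix (Fin n) (Fin n) ℝ, (∀ t s, t ≤ s → A t s = 0) ∧
    ∀ y : Fin n → ℝ, predictions F y = A.mulVec y

/-- The same up to a fixed offset vector that does not depend on the observations. -/
def IsAffineForecaster {n : ℕ} (F : Forecaster n) : Prop :=
  ∃ (A : Matrix (Fin n) (Fin n) ℝ) (b : Fin n → ℝ), (∀ t s, t ≤ s → A t s = 0) ∧
    ∀ y : Fin n → ℝ, predictions F y = A.mulVec y + b

/-- The quadratic loss `x ↦ (x - θ)²`. -/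
def sqLoss (θ x : ℝ) : ℝ := (x - θ) ^ 2

/-- The noisy gradient feedback at the point `x` when `y` is observed. -/
def noisyGradient (x y : ℝ) : ℝ := 2 * (x - y)

open Classical in
/-- The point played by restarting online gradient descent after `t` observations: it starts at
`x₁`, is put back to `x₁` in the rounds that belong to the set `R`, and otherwise takes a gradient
step with step size `η t`. Both `R` and `η` are fixed in advance. As `η` is indexed by the absolute
time, step sizes that are themselves reset in each batch are covered. -/
def ogdPlay (x₁ : ℝ) (η : ℕ → ℝ) (R : Set ℕ) : (t : ℕ) → (Fin t → ℝ) → ℝ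
  | 0, _ => x₁
  | t + 1, y =>
    if t + 1 ∈ R then x₁
    else
      ogdPlay x₁ η R t (Fin.init y)
        - η t * noisyGradient (ogdPlay x₁ η R t (Fin.init y)) (y (Fin.last t))

/-- Online gradient descent with a fixed restart schedule, as a forecasting strategy. -/
def restartingOGD (n : ℕ) (x₁ : ℝ) (η : ℕ → ℝ) (R : Set ℕ) : Forecaster n :=
  fun t y => ogdPlay x₁ η R t y

/-- Sequences of length `n` with total variation at most `C` and first entry at most `U` in
absolute value. -/
def tvClass (n : ℕ) (C U : ℝ) : Set (Fin n → ℝ) :=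
  {θ | (∑ i : Fin (n - 1), |θ ⟨i + 1, by omega⟩ - θ ⟨i, by omega⟩|) ≤ C ∧
    ∀ h : 0 < n, |θ ⟨0, h⟩| ≤ U}

/-- Independent, zero-mean, subgaussian noise whose variance is at least `σ ^ 2` in every round. -/
structure IsNoise {Ω : Type*} [MeasurableSpace Ω] (μ : Measure Ω) {n : ℕ}
    (Z : Fin n → Ω → ℝ) (σ : ℝ) : Prop where
  indep : iIndepFun Z μ
  mean_zero : ∀ t, ∫ ω, Z t ω ∂μ = 0
  subgaussian : ∀ t, ∃ K : NNReal, HasSubgaussianMGF (Z t) K μ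
  variance_ge : ∀ t, σ ^ 2 ≤ variance (Z t) μ

/-- The dynamic regret of `F` when the ground truth is `θ` and `θ t + Z t` is observed. -/
def dynamicRegret {Ω : Type*} [MeasurableSpace Ω] (μ : Measure Ω) {n : ℕ} (Z : Fin n → Ω → ℝ)
    (F : Forecaster n) (θ : Fin n → ℝ) : ℝ :=
  (∫ ω, ∑ t, sqLoss (θ t) (predictions F (fun s => θ s + Z s ω) t) ∂μ)
    - ∑ t, ⨅ x : ℝ, sqLoss (θ t) x

end

/-! Restarted gradient descent is affine in the observations, so one bound for `A y + b` with `A`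
strictly causal suffices. Its regret is at least squared bias plus `σ ^ 2` times the sum of the
squared entries of `A`. The hard sequences are single jumps `±C` at an unknown time `k`: averaging
the two signs removes `b`, and averaging over `k` forces a trade-off in every row. A row of small
norm cannot sum to nearly 1 over a short window, so it misses recent jumps
(`le_sum_sq_unitStep_sub`); a row of large norm pays in variance. The balancing window length is `m
= √n σ / C`. -/

/-! ### Gradient descent with restarts as an affine map -/

lemma ogdPlay_eq_affine (η : ℕ → ℝ) (R : Set ℕ) (t : ℕ) :
    ∃ (γ : ℝ) (w : Fin t → ℝ), ∀ (x₁ : ℝ) (y : Fin t → ℝ),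
      ogdPlay x₁ η R t y = γ * x₁ + ∑ s, w s * y s := by
  induction t with
  | zero => exact ⟨1, 0, fun x₁ y => by simp [ogdPlay]⟩
  | succ t ih =>
    obtain ⟨γ, w, h⟩ := ih
    by_cases hR : t + 1 ∈ R
    · exact ⟨1, 0, fun x₁ y => by simp [ogdPlay, hR]⟩
    · refine ⟨(1 - 2 * η t) * γ, Fin.snoc (fun s => (1 - 2 * η t) * w s) (2 * η t),
        fun x₁ y => ?_⟩
      rw [ogdPlay, if_neg hR, h, Fin.sum_univ_castSucc]
      simp only [noisyGradient, Fin.snoc_castSucc, Fin.snoc_last, Fin.init, mul_assoc,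
        ← Finset.mul_sum]
      ring

lemma sum_castLE_eq {n : ℕ} (t : Fin n) (w : Fin (t : ℕ) → ℝ) (y : Fin n → ℝ) :
    ∑ s, w s * y (Fin.castLE t.isLt.le s)
      = ∑ s : Fin n, (if h : (s : ℕ) < t then w ⟨s, h⟩ else 0) * y s := by
  symm
  rw [← Finset.sum_subset (Finset.subset_univ
    (Finset.univ.map (Fin.castLEEmb t.isLt.le)))]
  · rw [Finset.sum_map]
    refine Finset.sum_congr rfl fun s _ => ?_
    simp
  · intro s _ hs
    have : ¬ (s : ℕ) < t := fun h => hs (by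
      simp only [Finset.mem_map, Finset.mem_univ, true_and]
      exact ⟨⟨s, h⟩, rfl⟩)
    simp [this]

lemma exists_predictions_restartingOGD (n : ℕ) (η : ℕ → ℝ) (R : Set ℕ) :
    ∃ (A : Matrix (Fin n) (Fin n) ℝ) (γ : Fin n → ℝ), (∀ t s, t ≤ s → A t s = 0) ∧
      ∀ (x₁ : ℝ) (y : Fin n → ℝ),
        predictions (restartingOGD n x₁ η R) y = A.mulVec y + fun t => γ t * x₁ := by
  choose γ w h using ogdPlay_eq_affine η R
  refine ⟨fun t s => if h : (s : ℕ) < t then w t ⟨s, h⟩ else 0, fun t => γ t, ?_, ?_⟩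
  · intro t s hts
    have : ¬ (s : ℕ) < t := not_lt.mpr hts
    simp [this]
  · intro x₁ y
    ext t
    simp only [predictions, restartingOGD, h, Pi.add_apply, Matrix.mulVec, dotProduct]
    rw [sum_castLE_eq, add_comm]

lemma isLinearForecaster_restartingOGD (n : ℕ) (η : ℕ → ℝ) (R : Set ℕ) :
    IsLinearForecaster (restartingOGD n 0 η R) := by
  obtain ⟨A, γ, hA, h⟩ := exists_predictions_restartingOGD n η R
  refine ⟨A, hA, fun y => ?_⟩
  rw [h]
  ext t
  simp

lemma isAffineForecaster_restartingOGD (n : ℕ) (x₁ : ℝ) (η : ℕ → ℝ) (R : Set ℕ) :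
    IsAffineForecaster (restartingOGD n x₁ η R) := by
  obtain ⟨A, γ, hA, h⟩ := exists_predictions_restartingOGD n η R
  exact ⟨A, _, hA, fun y => h x₁ y⟩

lemma IsLinearForecaster.isAffineForecaster {n : ℕ} {F : Forecaster n}
    (hF : IsLinearForecaster F) : IsAffineForecaster F := by
  obtain ⟨A, hA, h⟩ := hF
  exact ⟨A, 0, hA, fun y => by rw [h, add_zero]⟩

lemma iInf_sqLoss (θ : ℝ) : ⨅ x : ℝ, sqLoss θ x = 0 := by
  refine le_antisymm ?_ (Real.iInf_nonneg fun x => sq_nonneg _)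
  refine (ciInf_le ⟨0, ?_⟩ θ).trans_eq (by simp [sqLoss])
  rintro _ ⟨x, rfl⟩
  exact sq_nonneg _

/-! ### Bias and variance under noise -/

section Noise

variable {Ω : Type*} [MeasurableSpace Ω] {μ : Measure Ω} {n : ℕ}
  {Z : Fin n → Ω → ℝ} {σ : ℝ}

lemma IsNoise.memLp (hZ : IsNoise μ Z σ) (t : Fin n) : MemLp (Z t) 2 μ := by
  obtain ⟨K, hK⟩ := hZ.subgaussian t
  exact_mod_cast hK.memLp 2

lemma IsNoise.memLp_sum_mul (hZ : IsNoise μ Z σ) (a : Fin n → ℝ) :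
    MemLp (fun ω => ∑ s, a s * Z s ω) 2 μ :=
  memLp_finsetSum _ fun s _ => (hZ.memLp s).const_mul (a s)

variable [IsProbabilityMeasure μ]

lemma IsNoise.integrable_sq (hZ : IsNoise μ Z σ) (a : Fin n → ℝ) (d : ℝ) :
    Integrable (fun ω => (d + ∑ s, a s * Z s ω) ^ 2) μ :=
  ((memLp_const d).add (hZ.memLp_sum_mul a)).integrable_sq

/-- Bias-variance bound for a linear functional of the noise. -/
lemma IsNoise.le_integral_sq (hZ : IsNoise μ Z σ) (a : Fin n → ℝ) (d : ℝ) :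
    d ^ 2 + σ ^ 2 * ∑ s, a s ^ 2 ≤ ∫ ω, (d + ∑ s, a s * Z s ω) ^ 2 ∂μ := by
  have hL := hZ.memLp_sum_mul a
  have hmean : ∫ ω, ∑ s, a s * Z s ω ∂μ = 0 := by
    rw [integral_finsetSum _ fun s _ =>
      ((hZ.memLp s).const_mul (a s)).integrable one_le_two]
    simp [integral_const_mul, hZ.mean_zero]
  have hvar : variance (fun ω => ∑ s, a s * Z s ω) μ = ∑ s, a s ^ 2 * variance (Z s) μ := by
    have h := IndepFun.variance_sum (μ := μ) (s := Finset.univ)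
      (X := fun s ω => a s * Z s ω)
      (fun s _ => (hZ.memLp s).const_mul (a s))
      (fun i _ j _ hij => (hZ.indep.indepFun hij).comp
        (measurable_const_mul (a i)) (measurable_const_mul (a j)))
    have he : (∑ s, fun ω => a s * Z s ω) = fun ω => ∑ s, a s * Z s ω := by
      ext ω
      simp
    rw [he] at h
    rw [h]
    exact Finset.sum_congr rfl fun s _ => variance_const_mul _ _ _
  have hadd := variance_const_add (μ := μ) hL.aestronglyMeasurable d
  have hL' : MemLp (fun ω => d + ∑ s, a s * Z s ω) 2 μ := (memLp_const d).add hL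
  rw [variance_eq_sub hL', hvar] at hadd
  have hm : ∫ ω, (d + ∑ s, a s * Z s ω) ∂μ = d := by
    rw [integral_add (integrable_const d) (hL.integrable one_le_two), hmean]
    simp
  have hle : σ ^ 2 * ∑ s, a s ^ 2 ≤ ∑ s, a s ^ 2 * variance (Z s) μ := by
    rw [Finset.mul_sum]
    refine Finset.sum_le_sum fun s _ => ?_
    rw [mul_comm]
    exact mul_le_mul_of_nonneg_left (hZ.variance_ge s) (sq_nonneg _)
  have hadd' : ∫ ω, (d + ∑ s, a s * Z s ω) ^ 2 ∂μ - (∫ ω, (d + ∑ s, a s * Z s ω) ∂μ) ^ 2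
      = ∑ s, a s ^ 2 * variance (Z s) μ := hadd
  rw [hm] at hadd'
  linarith

/-- The error in round `t` is a deterministic bias plus row `t` of `A` applied to the noise, and
every comparator loss is zero. -/
lemma IsNoise.le_dynamicRegret (hZ : IsNoise μ Z σ) {F : Forecaster n}
    {A : Matrix (Fin n) (Fin n) ℝ} {b : Fin n → ℝ}
    (hF : ∀ y, predictions F y = A.mulVec y + b) (θ : Fin n → ℝ) :
    ∑ t, (A.mulVec θ t + b t - θ t) ^ 2 + σ ^ 2 * ∑ t, ∑ s, A t s ^ 2
      ≤ dynamicRegret μ Z F θ := by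
  have h : ∀ ω t, sqLoss (θ t) (predictions F (fun s => θ s + Z s ω) t)
      = ((A.mulVec θ t + b t - θ t) + ∑ s, A t s * Z s ω) ^ 2 := by
    intro ω t
    rw [hF]
    simp only [sqLoss, Pi.add_apply, Matrix.mulVec, dotProduct, mul_add, Finset.sum_add_distrib]
    ring
  simp only [dynamicRegret, iInf_sqLoss, h, Finset.sum_const_zero, sub_zero]
  rw [integral_finsetSum _ fun t _ => hZ.integrable_sq (A t) (A.mulVec θ t + b t - θ t),
    Finset.mul_sum,
    ← Finset.sum_add_distrib]
  exact Finset.sum_le_sum fun t _ => hZ.le_integral_sq _ _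

end Noise

/-! ### Jump sequences and the trade-off in each row -/

/-- The unit step at time `k`, and the zero sequence for `k = 0`. -/
def unitStep {n : ℕ} (k t : Fin n) : ℝ := if 0 < (k : ℕ) ∧ k ≤ t then 1 else 0

lemma smul_unitStep_mem_tvClass {n : ℕ} (k : Fin n) {C U c : ℝ} (hc : |c| ≤ C) (hU : 0 ≤ U) :
    (fun t => c * unitStep k t) ∈ tvClass n C U := by
  have hC : 0 ≤ C := (abs_nonneg c).trans hc
  constructor
  · have hle : ∀ i : Fin (n - 1), |c * unitStep k ⟨i + 1, by omega⟩ - c * unitStep k ⟨i, by omega⟩|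
        ≤ if (i : ℕ) + 1 = k then C else 0 := by
      intro i
      simp only [unitStep, Fin.le_def]
      split_ifs <;> first | omega | simp [hc]
    refine (Finset.sum_le_sum fun i _ => hle i).trans ?_
    rw [← Finset.sum_filter, Finset.sum_const, nsmul_eq_mul]
    refine mul_le_of_le_one_left hC ?_
    norm_cast
    rw [Finset.card_le_one]
    intro i hi j hj
    simp only [Finset.mem_filter, Finset.mem_univ, true_and] at hi hj
    ext
    omega
  · intro h
    have : unitStep k ⟨0, h⟩ = 0 := by
      rw [unitStep, if_neg]
      simp only [Fin.le_def]
      omega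
    simpa [this] using hU

/-- After a jump at `k`, the prediction at `t` is the sum of `a` over `[k, t)`. By Cauchy-Schwarz it
stays at most 1/2 for all lags up to `m` unless `m * ∑ a ^ 2` exceeds 1/4. -/
lemma le_sum_sq_unitStep_sub {n : ℕ} (t : Fin n) (a : Fin n → ℝ) (ha : ∀ s, t ≤ s → a s = 0)
    {m : ℝ} (hm : 0 < m) (hmn : m ≤ n) :
    t * m / n / 4 ≤ ∑ k, (∑ s, a s * unitStep k s - unitStep k t) ^ 2 + m ^ 2 * ∑ s, a s ^ 2 := by
  have hn : (0 : ℝ) < n := hm.trans_le hmn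
  have htn : (t : ℝ) ≤ n := by exact_mod_cast t.isLt.le
  have htm : (t : ℝ) * m / n ≤ m := by
    rw [div_le_iff₀ hn]
    nlinarith
  have htt : (t : ℝ) * m / n ≤ t := by
    rw [div_le_iff₀ hn]
    exact mul_le_mul_of_nonneg_left hmn (Nat.cast_nonneg _)
  have hsum : 0 ≤ ∑ k, (∑ s, a s * unitStep k s - unitStep k t) ^ 2 :=
    Finset.sum_nonneg fun k _ => sq_nonneg _
  have ha2 : 0 ≤ ∑ s, a s ^ 2 := Finset.sum_nonneg fun s _ => sq_nonneg _
  rcases le_total (1 / 4) (m * ∑ s, a s ^ 2) with hbig | hsmall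
  · nlinarith
  -- `r` counts the jump times `k` with lag `t - k` in `0, …, ⌊m⌋`; the cap at `t` excludes `k = 0`,
  -- where there is no jump.
  · set r : ℕ := min t (⌊m⌋₊ + 1) with hr
    have hrt : r ≤ t := min_le_left _ _
    have hrle : (t : ℝ) * m / n ≤ r := by
      rcases min_choice (t : ℕ) (⌊m⌋₊ + 1) with h | h
      · rw [hr, h]
        exact htt
      · rw [hr, h]
        push_cast
        exact htm.trans (Nat.lt_floor_add_one m).le
    let κ : Fin n := ⟨t - r, by omega⟩
    have hcard : (Finset.Ioc κ t).card = r := by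
      rw [Fin.card_Ioc]
      simp only [κ]
      omega
    have hterm : ∀ k ∈ Finset.Ioc κ t,
        (1 / 4 : ℝ) ≤ (∑ s, a s * unitStep k s - unitStep k t) ^ 2 := by
      intro k hk
      rw [Finset.mem_Ioc, Fin.lt_def] at hk
      simp only [κ] at hk
      have hkt : (k : ℕ) ≤ t := hk.2
      have hlen : ((t - k : ℕ) : ℝ) ≤ m := by
        have : (t - k : ℕ) ≤ ⌊m⌋₊ := by omega
        exact (Nat.cast_le.mpr this).trans (Nat.floor_le hm.le)
      have hk1 : unitStep k t = 1 := if_pos ⟨by omega, hk.2⟩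
      have hS : ∑ s, a s * unitStep k s = ∑ s ∈ Finset.Ico k t, a s := by
        rw [← Finset.sum_subset (Finset.subset_univ (Finset.Ico k t))]
        · refine Finset.sum_congr rfl fun s hs => ?_
          rw [unitStep, if_pos ⟨by omega, (Finset.mem_Ico.mp hs).1⟩, mul_one]
        · intro s _ hs
          by_cases hst : t ≤ s
          · rw [ha s hst, zero_mul]
          · rw [unitStep, if_neg, mul_zero]
            exact fun h => hs (Finset.mem_Ico.mpr ⟨h.2, not_le.mp hst⟩)
      have hcs : (∑ s ∈ Finset.Ico k t, a s) ^ 2 ≤ 1 / 4 := by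
        calc (∑ s ∈ Finset.Ico k t, a s) ^ 2
            ≤ (Finset.Ico k t).card * ∑ s ∈ Finset.Ico k t, a s ^ 2 := sq_sum_le_card_mul_sum_sq
          _ ≤ m * ∑ s, a s ^ 2 := by
              rw [Fin.card_Ico]
              refine mul_le_mul hlen ?_ (Finset.sum_nonneg fun s _ => sq_nonneg _) hm.le
              exact Finset.sum_le_sum_of_subset_of_nonneg (Finset.subset_univ _)
                fun s _ _ => sq_nonneg _
          _ ≤ 1 / 4 := hsmall
      rw [hS, hk1]
      have habs := abs_le_of_sq_le_sq (a := ∑ s ∈ Finset.Ico k t, a s) (b := 1 / 2)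
        (by norm_num; linarith) (by norm_num)
      nlinarith [le_abs_self (∑ s ∈ Finset.Ico k t, a s)]
    have hlow : (r : ℝ) * (1 / 4) ≤ ∑ k, (∑ s, a s * unitStep k s - unitStep k t) ^ 2 := by
      calc (r : ℝ) * (1 / 4) = ∑ _k ∈ Finset.Ioc κ t, (1 / 4 : ℝ) := by
            rw [Finset.sum_const, hcard, nsmul_eq_mul]
        _ ≤ ∑ k ∈ Finset.Ioc κ t, (∑ s, a s * unitStep k s - unitStep k t) ^ 2 :=
            Finset.sum_le_sum hterm
        _ ≤ _ := Finset.sum_le_sum_of_subset_of_nonneg (Finset.subset_univ _)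
            fun k _ _ => sq_nonneg _
    have : 0 ≤ m ^ 2 * ∑ s, a s ^ 2 := by positivity
    linarith

/-- Averaged over the step times, squared bias plus variance of a strictly causal linear map. -/
lemma le_sum_sq_mulVec_unitStep_sub {n : ℕ} (hn : 2 ≤ n) (A : Matrix (Fin n) (Fin n) ℝ)
    (hA : ∀ t s, t ≤ s → A t s = 0) {m : ℝ} (hm : 0 < m) (hmn : m ≤ n) :
    n * m / 16 ≤ ∑ k, ∑ t, (A.mulVec (unitStep k) t - unitStep k t) ^ 2
      + m ^ 2 * ∑ t, ∑ s, A t s ^ 2 := by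
  have h := Finset.sum_le_sum fun (t : Fin n) (_ : t ∈ Finset.univ) =>
    le_sum_sq_unitStep_sub t (A t) (hA t) hm hmn
  rw [Finset.sum_add_distrib, ← Finset.mul_sum, Finset.sum_comm] at h
  refine le_trans ?_ h
  rw [← Finset.sum_div, ← Finset.sum_div, ← Finset.sum_mul,
    Fin.sum_univ_eq_sum_range (fun i => (i : ℝ)) n]
  have hg : (∑ i ∈ Finset.range n, (i : ℝ)) * 2 = n * (n - 1) := by
    have := Finset.sum_range_id_mul_two n
    rw [← Nat.cast_sum]
    rw [← Nat.cast_pred (by omega)]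
    exact_mod_cast this
  have hn' : (2 : ℝ) ≤ n := by exact_mod_cast hn
  have hs : (∑ i ∈ Finset.range n, (i : ℝ)) = n * (n - 1) / 2 := by linarith
  rw [hs]
  have : (n : ℝ) * (n - 1) / 2 * m / n / 4 = (n - 1) * m / 8 := by
    field_simp
    ring
  rw [this]
  -- `n - 1 ≥ n / 2` turns the factor 1/8 into 1/16.
  nlinarith

lemma IsAffineForecaster.exists_le_dynamicRegret {n : ℕ} {C U σ : ℝ} (hn : 2 ≤ n) (hC : 0 < C)
    (hU : 0 ≤ U) (hσ : 0 < σ) (hσC : σ ≤ C * Real.sqrt n) {Ω : Type*} [MeasurableSpace Ω]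
    {μ : Measure Ω} [IsProbabilityMeasure μ] {Z : Fin n → Ω → ℝ} (hZ : IsNoise μ Z σ)
    {F : Forecaster n} (hF : IsAffineForecaster F) :
    ∃ θ ∈ tvClass n C U, 1 / 16 * σ * C * Real.sqrt n ≤ dynamicRegret μ Z F θ := by
  obtain ⟨A, b, hA, hF⟩ := hF
  by_contra! hlt
  have hn0 : (0 : ℝ) < n := by exact_mod_cast (by omega : 0 < n)
  have hsq : Real.sqrt n * Real.sqrt n = n := Real.mul_self_sqrt hn0.le
  have hs : 0 < Real.sqrt n := Real.sqrt_pos.mpr hn0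
  set V : ℝ := ∑ t, ∑ s, A t s ^ 2
  have hk : ∀ k : Fin n, C ^ 2 * ∑ t, (A.mulVec (unitStep k) t - unitStep k t) ^ 2
      < 1 / 16 * σ * C * Real.sqrt n - σ ^ 2 * V := by
    intro k
    have key : ∀ c : ℝ, |c| ≤ C →
        ∑ t, (c * (A.mulVec (unitStep k) t - unitStep k t) + b t) ^ 2
          < 1 / 16 * σ * C * Real.sqrt n - σ ^ 2 * V := by
      intro c hc
      have h1 := (hZ.le_dynamicRegret hF _).trans_lt
        (hlt _ (smul_unitStep_mem_tvClass (U := U) k hc hU))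
      have h2 : ∀ t, A.mulVec (fun t => c * unitStep k t) t + b t - c * unitStep k t
          = c * (A.mulVec (unitStep k) t - unitStep k t) + b t := by
        intro t
        have : A.mulVec (fun t => c * unitStep k t) = c • A.mulVec (unitStep k) :=
          Matrix.mulVec_smul A c (unitStep k)
        rw [this, Pi.smul_apply, smul_eq_mul]
        ring
      simp only [h2] at h1
      linarith
    have hp := key C (abs_of_pos hC).le
    have hm := key (-C) (by rw [abs_neg, abs_of_pos hC])
    -- The cross terms with `b` cancel between the signs, and `b t ^ 2` is dropped.
    have hmid : C ^ 2 * ∑ t, (A.mulVec (unitStep k) t - unitStep k t) ^ 2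
        ≤ (∑ t, (C * (A.mulVec (unitStep k) t - unitStep k t) + b t) ^ 2
          + ∑ t, (-C * (A.mulVec (unitStep k) t - unitStep k t) + b t) ^ 2) / 2 := by
      rw [← Finset.sum_add_distrib, Finset.mul_sum, Finset.sum_div]
      refine Finset.sum_le_sum fun t _ => ?_
      nlinarith [sq_nonneg (b t)]
    linarith
  have hsum := Finset.sum_lt_sum_of_nonempty (s := (Finset.univ : Finset (Fin n)))
    ⟨⟨0, by omega⟩, Finset.mem_univ _⟩ fun k _ => hk k
  rw [← Finset.mul_sum, Finset.sum_const, Finset.card_univ, Fintype.card_fin, nsmul_eq_mul] at hsum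
  -- This `m` satisfies `C ^ 2 * m ^ 2 = n * σ ^ 2`, matching the variance summed over the `n` jump
  -- times; `m ≤ n` is the hypothesis `σ ≤ C √n`.
  have hm : 0 < Real.sqrt n * σ / C := by positivity
  have hmn : Real.sqrt n * σ / C ≤ n := by
    rw [div_le_iff₀ hC]
    nlinarith
  have hlow := mul_le_mul_of_nonneg_left (le_sum_sq_mulVec_unitStep_sub hn A hA hm hmn)
    (sq_nonneg C)
  have e1 : C ^ 2 * (n * (Real.sqrt n * σ / C) / 16) = n * (1 / 16 * σ * C * Real.sqrt n) := by
    field_simp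
  have e2 : C ^ 2 * ((Real.sqrt n * σ / C) ^ 2 * V) = n * (σ ^ 2 * V) := by
    rw [div_pow, mul_pow, pow_two (Real.sqrt n), hsq]
    field_simp
  rw [mul_add, e1, e2] at hlow
  linarith

theorem proposition1 :
    (∀ (n : ℕ) (η : ℕ → ℝ) (R : Set ℕ), IsLinearForecaster (restartingOGD n 0 η R)) ∧
    (∀ (n : ℕ) (x₁ : ℝ) (η : ℕ → ℝ) (R : Set ℕ), IsAffineForecaster (restartingOGD n x₁ η R)) ∧
    ∃ c : ℝ, 0 < c ∧
      ∀ (n : ℕ) (C U σ : ℝ), 2 ≤ n → 0 < C → 0 ≤ U → 0 < σ → σ ≤ C * Real.sqrt n →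
      ∀ (Ω : Type*) [MeasurableSpace Ω] (μ : Measure Ω) [IsProbabilityMeasure μ]
        (Z : Fin n → Ω → ℝ), IsNoise μ Z σ →
        (∀ F : Forecaster n, IsLinearForecaster F →
          ∃ θ ∈ tvClass n C U, c * σ * C * Real.sqrt n ≤ dynamicRegret μ Z F θ) ∧
        (∀ (x₁ : ℝ) (η : ℕ → ℝ) (R : Set ℕ),
          ∃ θ ∈ tvClass n C U,
            c * σ * C * Real.sqrt n ≤ dynamicRegret μ Z (restartingOGD n x₁ η R) θ) := by
  refine ⟨isLinearForecaster_restartingOGD, isAffineForecaster_restartingOGD, 1 / 16,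
    by norm_num, ?_⟩
  intro n C U σ hn hC hU hσ hσC Ω _ μ _ Z hZ
  exact ⟨fun F hF => hF.isAffineForecaster.exists_le_dynamicRegret hn hC hU hσ hσC hZ,
    fun x₁ η R => (isAffineForecaster_restartingOGD n x₁ η R).exists_le_dynamicRegret
      hn hC hU hσ hσC hZ⟩
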